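/- A continuum is a nonempty compact connected metric space, and a subcontinuum of $X$ is a nonempty compact connected subset of $X$. Let $X$ be a continuum and let $2^X$ be the hyperspace of all nonempty closed subsets of $X$ with the Hausdorff metric. For $A\subseteq X$ and $y\in X$ let $\kappa_{X\setminus A}(y)$ be the union of all subcontinua $L$ of $X$ with $y\in L\subseteq X\setminus A$. Let $\mathcal{NB}(\mathcal F_1(X))$ be the set of all $A\in 2^X$ with $A\neq X$ such that $\kappa_{X\setminus A}(y)$ is dense in $X$ for every $y\in X\setminus A$, with the subspace topology from $2^X$. For $x\in X$ let $\pi(x)$ be the intersection of all $A\in\mathcal{NB}(\mathcal F_1(X))$ with $x\in A$ if there is such an $A$, and $\pi(x)=X$ otherwise; and let $$B(x)=\{y\in X : \mathrm{Cl}(\kappa_{X\setminus\{x\}}(y))\neq X\}$$ be the set of points that $x$ blocks (so $x\in B(x)$, since $\kappa_{X\setminus\{x\}}(x)=\emptyset$). The continuum $X$ is decomposable if it is the union of two proper subcontinua. It has the property of Kelley if, whenever $x_n\to x$ in $X$ and $K$ is a subcontinuum of $X$ with $x\in K$, there are subcontinua $K_n$ of $X$ with $x_n\in K_n$ for every $n$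 and $K_n\to K$ in the Hausdorff metric. **Proposition.** Let $X$ be a decomposable continuum with the property of Kelley such that $\mathcal{NB}(\mathcal F_1(X))$ is a continuum (that is, nonempty, compact and connected). Then $\pi(x)=B(x)$ for every $x\in X$. In particular, $B(x)$ is closed for every $x\in X$. -/

import Mathlib

open Set Filter Topology TopologicalSpace

namespace Nonblockers

/-- A (sub)continuum: a nonempty, compact, connected subset (`IsConnected` includes nonemptiness).
For the ambient metric space `X`, points of the hyperspace `2^X` are the elements of
`NonemptyCompacts X`, with the Hausdorff metric. -/
def IsSubcontinuum {X : Type*} [TopologicalSpace X] (L : Set X) : Prop :=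
  IsCompact L ∧ IsConnected L

/-- The space is the union of two proper subcontinua. -/
def Decomposable (X : Type*) [TopologicalSpace X] : Prop :=
  ∃ M N : Set X, IsSubcontinuum M ∧ IsSubcontinuum N ∧ M ≠ univ ∧ N ≠ univ ∧ M ∪ N = univ

/-- The property of Kelley; convergence of continua is in the Hausdorff metric. -/
def PropertyOfKelley (X : Type*) [MetricSpace X] : Prop :=
  ∀ (x : ℕ → X) (p : X), Tendsto x atTop (𝓝 p) →
    ∀ A : NonemptyCompacts X, IsSubcontinuum (A : Set X) → p ∈ A →
      ∃ K : ℕ → NonemptyCompacts X,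
        (∀ n, IsSubcontinuum (K n : Set X) ∧ x n ∈ K n) ∧ Tendsto K atTop (𝓝 A)

/-- The union `κ_{X ∖ A}(B)` of all subcontinua that meet `B` and are contained in `X ∖ A`. -/
def kappa {X : Type*} [TopologicalSpace X] (A B : Set X) : Set X :=
  ⋃₀ {L : Set X | IsSubcontinuum L ∧ (B ∩ L).Nonempty ∧ L ⊆ Aᶜ}

/-- `A` blocks `B`: the closure of `κ_{X ∖ A}(B)` is not the whole space. -/
def Blocks {X : Type*} [TopologicalSpace X] (A B : Set X) : Prop :=
  closure (kappa A B) ≠ univ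

/-- The hyperspace of nonblockers of singletons: the *proper* nonempty closed subsets of the
compact metric space `X` that block no point of their complement. -/
def NB (X : Type*) [MetricSpace X] : Set (NonemptyCompacts X) :=
  {A | (A : Set X) ≠ univ ∧ ∀ x : X, x ∉ A → ¬ Blocks (A : Set X) {x}}

open Classical in
/-- The intersection of all nonblockers containing `x`, or the whole space if there is none. -/
noncomputable def minimalNonblocker {X : Type*} [MetricSpace X] (x : X) : Set X :=
  if ∃ A ∈ NB X, x ∈ A then ⋂ A ∈ {A | A ∈ NB X ∧ x ∈ A}, (A : Set X) else univ

/-- The set `B(x)` of the points blocked by `x`. It contains `x`, as `κ_{X ∖ {x}}(x) = ∅`. -/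
def blockedSet {X : Type*} [TopologicalSpace X] (x : X) : Set X :=
  {y | Blocks {x} {y}}

end Nonblockers

/-!
For a closed set `S` and a continuum `K` disjoint from `S`, the *hull* of `S` seen from `K` is the
complement of `κ_{X ∖ S}(K)`. In a continuum with the property of Kelley, if `K` has nonempty
interior, then `κ_{X ∖ S}(K)` is open (`isOpen_kappa`), and if the hull moreover has empty interior,
it is a nonblocker (`exists_mem_NB_coe_eq_compl_kappa`), because then `κ_{X ∖ S}(K)` is a dense set
any two of whose points lie in a common continuum inside it.

The key point is that every `x` is missed by some continuum with nonempty interior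
(`exists_isSubcontinuum_interior_nonempty_notMem`). Let `M` be a proper continuum with nonempty
interior, which exists as `X` is decomposable, and assume that every continuum with nonempty
interior contains `x`. For a finite set `S` outside `M`, boundary bumping shows that every component
of the hull of `S` meets `S`. So the hull is a finite union of continua which miss `M`, hence miss
`x`, hence have empty interior: the hull of every such `S` is a nonblocker. Since the hyperspace of
nonblockers is compact, some nonblocker contains the whole nonempty open set `X ∖ M`, which is
impossible, as a nonblocker has empty interior.

Now fix `x` and a continuum `K` with nonempty interior which misses `x`. If `x` fails to block some
`y`, then the dense set `κ_{X ∖ {x}}(y)` meets the interior of `K`, so `κ_{X ∖ {x}}(K)` is dense and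
open. Its complement is then exactly `B(x)`, so `B(x)` is a nonblocker containing `x`; and `B(x)` is
contained in every nonblocker containing `x`. If `x` blocks every point, then no proper set contains
`B(x)`, and both sets are the whole space.
-/

namespace Nonblockers

/-! ### Unions of continua avoiding a set -/

section Kappa

variable {X : Type*} [TopologicalSpace X] {A B K L S : Set X} {x y z : X}

theorem mem_kappa :
    z ∈ kappa A B ↔ ∃ L, IsSubcontinuum L ∧ (B ∩ L).Nonempty ∧ L ⊆ Aᶜ ∧ z ∈ L := by
  simp [kappa, mem_sUnion, and_assoc]

theorem isSubcontinuum_singleton (x : X) : IsSubcontinuum ({x} : Set X) :=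
  ⟨isCompact_singleton, isConnected_singleton⟩

theorem IsSubcontinuum.union (hK : IsSubcontinuum K) (hL : IsSubcontinuum L)
    (h : (K ∩ L).Nonempty) : IsSubcontinuum (K ∪ L) :=
  ⟨hK.1.union hL.1, hK.2.union h hL.2⟩

theorem IsSubcontinuum.subset_kappa (hL : IsSubcontinuum L) (hB : (B ∩ L).Nonempty)
    (hA : L ⊆ Aᶜ) : L ⊆ kappa A B :=
  fun _ hz => mem_kappa.2 ⟨L, hL, hB, hA, hz⟩

theorem kappa_subset_compl (A B : Set X) : kappa A B ⊆ Aᶜ := by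
  rintro z hz
  obtain ⟨L, -, -, hA, hzL⟩ := mem_kappa.1 hz
  exact hA hzL

theorem kappa_anti_left (h : A ⊆ S) (B : Set X) : kappa S B ⊆ kappa A B := by
  rintro z hz
  obtain ⟨L, hL, hB, hS, hzL⟩ := mem_kappa.1 hz
  exact mem_kappa.2 ⟨L, hL, hB, hS.trans (compl_subset_compl.2 h), hzL⟩

theorem mem_kappa_singleton_self (h : x ∉ A) : x ∈ kappa A {x} :=
  mem_kappa.2 ⟨{x}, isSubcontinuum_singleton x, ⟨x, rfl, rfl⟩, by simpa using h, rfl⟩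

theorem exists_isSubcontinuum_of_mem_kappa (hK : IsSubcontinuum K) (hKS : K ⊆ Sᶜ)
    (hz : z ∈ kappa S K) : ∃ L, IsSubcontinuum L ∧ K ⊆ L ∧ L ⊆ Sᶜ ∧ z ∈ L := by
  obtain ⟨L, hL, hKL, hLS, hzL⟩ := mem_kappa.1 hz
  exact ⟨K ∪ L, hK.union hL hKL, subset_union_left, union_subset hKS hLS, Or.inr hzL⟩

theorem kappa_subset_kappa_compl_kappa (hK : IsSubcontinuum K) (hKS : K ⊆ Sᶜ)
    (hz : z ∈ kappa S K) : kappa S K ⊆ kappa (kappa S K)ᶜ {z} := by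
  obtain ⟨L, hL, hKL, hLS, hzL⟩ := exists_isSubcontinuum_of_mem_kappa hK hKS hz
  intro w hw
  obtain ⟨L', hL', hKL', hLS', hwL'⟩ := exists_isSubcontinuum_of_mem_kappa hK hKS hw
  obtain ⟨k, hk⟩ := hK.2.nonempty
  refine mem_kappa.2 ⟨L ∪ L', hL.union hL' ⟨k, hKL hk, hKL' hk⟩, ⟨z, rfl, Or.inl hzL⟩, ?_,
    Or.inr hwL'⟩
  rw [compl_compl]
  exact (hL.union hL' ⟨k, hKL hk, hKL' hk⟩).subset_kappa ⟨k, hk, Or.inl (hKL hk)⟩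
    (union_subset hLS hLS')

/-- A dense `κ_{X ∖ S}(y)` meets the interior of `K`, so some continuum off `S` joins `y` to `K`. -/
theorem mem_kappa_of_dense (hint : (interior K).Nonempty) (hy : Dense (kappa S {y})) :
    y ∈ kappa S K := by
  obtain ⟨w, hwK, hw⟩ := hy.inter_open_nonempty _ isOpen_interior hint
  obtain ⟨L, hL, ⟨y', rfl, hyL⟩, hLS, hwL⟩ := mem_kappa.1 hw
  exact mem_kappa.2 ⟨L, hL, ⟨w, interior_subset hwK, hwL⟩, hLS, hyL⟩

theorem mem_blockedSet_self (x : X) : x ∈ blockedSet x := by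
  have : kappa {x} {x} = (∅ : Set X) := by
    rw [eq_empty_iff_forall_notMem]
    intro z hz
    obtain ⟨L, -, ⟨_, rfl, hxL⟩, hLx, -⟩ := mem_kappa.1 hz
    exact hLx hxL rfl
  change closure (kappa {x} {x}) ≠ univ
  rw [this, closure_empty]
  exact fun h => notMem_empty x (h ▸ mem_univ x)

end Kappa

/-! ### Boundary bumping -/

theorem isClosed_connectedComponentIn {X : Type*} [TopologicalSpace X] {F : Set X}
    (hF : IsClosed F) (w : X) : IsClosed (connectedComponentIn F w) := by
  by_cases hw : w ∈ F
  · rw [connectedComponentIn_eq_image hw]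
    exact hF.isClosedEmbedding_subtypeVal.isClosedMap _ isClosed_connectedComponent
  · rw [connectedComponentIn_eq_empty hw]
    exact isClosed_empty

/-- In a compact connected Hausdorff space, a component of a proper closed set reaches the closure
of the complement of that set. -/
theorem connectedComponentIn_inter_closure_compl_nonempty {X : Type*} [TopologicalSpace X]
    [CompactSpace X] [T2Space X] [ConnectedSpace X] {H : Set X} (hH : IsClosed H)
    (hne : H ≠ univ) {w : X} (hw : w ∈ H) :
    (connectedComponentIn H w ∩ closure Hᶜ).Nonempty := by
  by_contra hcon
  have hHc : CompactSpace H := isCompact_iff_compactSpace.1 hH.isCompact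
  have hF : IsClosed ((↑) ⁻¹' closure Hᶜ : Set H) := isClosed_closure.preimage continuous_subtype_val
  -- Components of the compact space `H` are intersections of clopen sets, so by compactness some
  -- clopen subset of `H` containing `w` is disjoint from `closure Hᶜ`.
  obtain ⟨Z, hZ, hwZ, hZF⟩ : ∃ Z : Set H, IsClopen Z ∧ ⟨w, hw⟩ ∈ Z ∧
      Disjoint Z ((↑) ⁻¹' closure Hᶜ) := by
    have hcc := connectedComponent_eq_iInter_isClopen (⟨w, hw⟩ : H)
    have hdis : ((↑) ⁻¹' closure Hᶜ : Set H) ∩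
        ⋂ s : { s : Set H // IsClopen s ∧ ⟨w, hw⟩ ∈ s }, (s : Set H) = ∅ := by
      rw [← hcc]
      by_contra hn
      obtain ⟨v, hv, hvc⟩ := nonempty_iff_ne_empty.2 hn
      refine hcon ⟨v, ?_, hv⟩
      rw [connectedComponentIn_eq_image hw]
      exact ⟨v, hvc, rfl⟩
    obtain ⟨t, ht⟩ := hF.isCompact.elim_finite_subfamily_closed _ (fun s => s.2.1.1) hdis
    refine ⟨⋂ i ∈ t, (i : Set H), isClopen_biInter_finset fun i _ => i.2.1,
      mem_iInter₂.2 fun i _ => i.2.2, ?_⟩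
    rw [Set.disjoint_iff_inter_eq_empty, inter_comm]
    exact ht
  -- Such a set is clopen in the whole space.
  have hcl : IsClosed ((↑) '' Z : Set X) := hH.isClosedEmbedding_subtypeVal.isClosedMap _ hZ.1
  have hop : IsOpen ((↑) '' Z : Set X) := by
    obtain ⟨O, hO, rfl⟩ := isOpen_induced_iff.1 hZ.2
    have : ((↑) '' ((↑) ⁻¹' O : Set H) : Set X) = O ∩ (closure Hᶜ)ᶜ := by
      ext v
      constructor
      · rintro ⟨v, hv, rfl⟩
        exact ⟨hv, fun h => Set.disjoint_left.1 hZF hv h⟩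
      · rintro ⟨hv, hvc⟩
        have hvH : v ∈ H := by
          by_contra h
          exact hvc (subset_closure h)
        exact ⟨⟨v, hvH⟩, hv, rfl⟩
    rw [this]
    exact hO.inter isClosed_closure.isOpen_compl
  have huniv := IsClopen.eq_univ ⟨hcl, hop⟩ ⟨w, ⟨w, hw⟩, hwZ, rfl⟩
  refine hne (eq_univ_of_univ_subset ?_)
  rw [← huniv]
  rintro _ ⟨v, -, rfl⟩
  exact v.2

theorem closure_kappa_singleton_inter_nonempty {X : Type*} [TopologicalSpace X]
    [CompactSpace X] [T2Space X] [ConnectedSpace X] {A : Set X} (hA : IsClosed A)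
    (hne : A.Nonempty) {w : X} (hw : w ∉ A) : (closure (kappa A {w}) ∩ A).Nonempty := by
  by_contra hcon
  obtain ⟨U, V, hU, hV, hAU, hCV, hUV⟩ := normal_separation hA isClosed_closure
    (Set.disjoint_left.2 fun a ha hac => hcon ⟨a, hac, ha⟩)
  have hwV : w ∈ V := hCV (subset_closure (mem_kappa_singleton_self hw))
  have hwU : w ∈ Uᶜ := fun h => Set.disjoint_left.1 hUV h hwV
  obtain ⟨v, hv, hvU⟩ := connectedComponentIn_inter_closure_compl_nonempty hU.isClosed_compl
    (fun h => by
      obtain ⟨a, ha⟩ := hne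
      have : a ∈ Uᶜ := h ▸ mem_univ a
      exact this (hAU ha)) hwU
  have hsub : IsSubcontinuum (connectedComponentIn Uᶜ w) :=
    ⟨(isClosed_connectedComponentIn hU.isClosed_compl w).isCompact,
      isConnected_connectedComponentIn_iff.2 hwU⟩
  have hvk : v ∈ kappa A {w} := hsub.subset_kappa
    (singleton_inter_nonempty.2 (mem_connectedComponentIn hwU))
    ((connectedComponentIn_subset _ _).trans (compl_subset_compl.2 hAU)) hv
  rw [compl_compl] at hvU
  obtain ⟨u, huV, huU⟩ := mem_closure_iff.1 hvU V hV (hCV (subset_closure hvk))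
  exact Set.disjoint_left.1 hUV huU huV

/-! ### Hulls of closed sets -/

section Metric

variable {X : Type*} [MetricSpace X] {K S : Set X} {x : X}

theorem isOpen_kappa (hKelley : PropertyOfKelley X) (hK : IsSubcontinuum K)
    (hint : (interior K).Nonempty) (hS : IsClosed S) (hKS : K ⊆ Sᶜ) : IsOpen (kappa S K) := by
  rw [← isClosed_compl_iff, ← isSeqClosed_iff_isClosed]
  intro u z hu huz hz
  obtain ⟨L, hL, hKL, hLS, hzL⟩ := exists_isSubcontinuum_of_mem_kappa hK hKS hz
  obtain ⟨C, hC, hCL⟩ := hKelley u z huz ⟨⟨L, hL.1⟩, hL.2.nonempty⟩ hL hzL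
  -- Continua close to `L` miss `S` and meet the interior of `K`.
  have h1 : ∀ᶠ n in atTop, (C n : Set X) ⊆ Sᶜ :=
    hCL.eventually ((NonemptyCompacts.isOpen_subsets_of_isOpen hS.isOpen_compl).mem_nhds hLS)
  have h2 : ∀ᶠ n in atTop, ((C n : Set X) ∩ interior K).Nonempty :=
    hCL.eventually ((NonemptyCompacts.isOpen_inter_nonempty_of_isOpen isOpen_interior).mem_nhds
      (by
        obtain ⟨k, hk⟩ := hint
        exact ⟨k, hKL (interior_subset hk), hk⟩))
  obtain ⟨n, hn1, k, hkC, hkK⟩ := (h1.and h2).exists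
  exact hu n ((hC n).1.subset_kappa ⟨k, interior_subset hkK, hkC⟩ hn1 (hC n).2)

theorem interior_eq_empty_of_mem_NB {A : NonemptyCompacts X} (hA : A ∈ NB X) :
    interior (A : Set X) = ∅ := by
  obtain ⟨z, hz⟩ := (ne_univ_iff_exists_notMem _).1 hA.1
  have hd : Dense (kappa (A : Set X) {z}) := dense_iff_closure_eq.2 (not_not.1 (hA.2 z hz))
  rw [interior_eq_empty_iff_dense_compl]
  exact hd.mono (kappa_subset_compl _ _)

variable [CompactSpace X]

/-- The hull of a closed set is a nonblocker if it has empty interior. -/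
theorem exists_mem_NB_coe_eq_compl_kappa (hKelley : PropertyOfKelley X) (hK : IsSubcontinuum K)
    (hint : (interior K).Nonempty) (hS : IsClosed S) (hne : S.Nonempty) (hKS : K ⊆ Sᶜ)
    (hd : Dense (kappa S K)) : ∃ A ∈ NB X, (A : Set X) = (kappa S K)ᶜ := by
  have hcl := (isOpen_kappa hKelley hK hint hS hKS).isClosed_compl
  refine ⟨⟨⟨(kappa S K)ᶜ, hcl.isCompact⟩,
    hne.mono (subset_compl_comm.1 (kappa_subset_compl S K))⟩, ⟨?_, ?_⟩, rfl⟩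
  · intro h
    obtain ⟨k, hk⟩ := hK.2.nonempty
    have hk' : k ∈ (kappa S K)ᶜ := by
      have := mem_univ k
      rwa [← h] at this
    exact hk' (hK.subset_kappa (by simpa using hK.2.nonempty) hKS hk)
  · intro z hz hb
    have hz' : z ∈ kappa S K := not_not.1 hz
    exact hb (hd.mono (kappa_subset_kappa_compl_kappa hK hKS hz')).closure_eq

variable [ConnectedSpace X]

/-- By boundary bumping, every component of the hull of `S` meets `S`. -/
theorem exists_mem_connectedComponentIn_compl_kappa (hS : IsClosed S) (hne : S.Nonempty)
    (hO : IsOpen (kappa S K)) {w : X} (hw : w ∉ kappa S K) :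
    ∃ s ∈ S, w ∈ connectedComponentIn (kappa S K)ᶜ s := by
  by_cases hwS : w ∈ S
  · exact ⟨w, hwS, mem_connectedComponentIn hw⟩
  obtain ⟨s, hsc, hs⟩ := closure_kappa_singleton_inter_nonempty hS hne hwS
  refine ⟨s, hs, ?_⟩
  have hpre : IsPreconnected (kappa S {w}) := by
    refine isPreconnected_sUnion w _ ?_ fun L hL => hL.1.2.isPreconnected
    rintro L ⟨-, ⟨w', rfl, hwL⟩, -⟩
    exact hwL
  -- A continuum through `w` off `S` cannot reach `K`, nor anything reached from `K`.
  have hsub : kappa S {w} ⊆ (kappa S K)ᶜ := by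
    intro v hv hvK
    obtain ⟨L, hL, ⟨w', rfl, hwL⟩, hLS, hvL⟩ := mem_kappa.1 hv
    obtain ⟨L', hL', ⟨k, hkK, hkL'⟩, hLS', hvL'⟩ := mem_kappa.1 hvK
    exact hw (mem_kappa.2 ⟨L' ∪ L, hL'.union hL ⟨v, hvL', hvL⟩, ⟨k, hkK, Or.inl hkL'⟩,
      union_subset hLS' hLS, Or.inr hwL⟩)
  exact hpre.closure.subset_connectedComponentIn hsc
    (closure_minimal hsub hO.isClosed_compl) (subset_closure (mem_kappa_singleton_self hwS))

/-! ### Continua with nonempty interior -/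

/-- A finite union of closed sets with empty interior has empty interior. -/
theorem interior_biUnion_eq_empty_of_finite {Y ι : Type*} [TopologicalSpace Y] {T : Set ι}
    (hT : T.Finite) {f : ι → Set Y} (hc : ∀ i ∈ T, IsClosed (f i))
    (hi : ∀ i ∈ T, interior (f i) = ∅) : interior (⋃ i ∈ T, f i) = ∅ := by
  induction T, hT using Set.Finite.induction_on with
  | empty => simp
  | insert _ _ ih =>
    rw [biUnion_insert, interior_union_isClosed_of_interior_empty (hc _ (mem_insert _ _))
      (ih (fun i h => hc i (mem_insert_of_mem _ h)) fun i h => hi i (mem_insert_of_mem _ h))]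
    exact hi _ (mem_insert _ _)

theorem dense_kappa_of_finite (hKelley : PropertyOfKelley X)
    (hx : ∀ L : Set X, IsSubcontinuum L → (interior L).Nonempty → x ∈ L)
    (hK : IsSubcontinuum K) (hint : (interior K).Nonempty) (hfin : S.Finite)
    (hne : S.Nonempty) (hKS : K ⊆ Sᶜ) : Dense (kappa S K) := by
  have hO := isOpen_kappa hKelley hK hint hfin.isClosed hKS
  have hSsub : S ⊆ (kappa S K)ᶜ := subset_compl_comm.1 (kappa_subset_compl S K)
  have hxk : x ∈ kappa S K := hK.subset_kappa (by simpa using hK.2.nonempty) hKS (hx K hK hint)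
  have hcomp : (kappa S K)ᶜ ⊆ ⋃ s ∈ S, connectedComponentIn (kappa S K)ᶜ s := by
    intro w hw
    obtain ⟨s, hs, hws⟩ := exists_mem_connectedComponentIn_compl_kappa hfin.isClosed hne hO hw
    exact mem_iUnion₂.2 ⟨s, hs, hws⟩
  rw [← compl_compl (kappa S K), ← interior_eq_empty_iff_dense_compl, ← subset_empty_iff]
  refine (interior_mono hcomp).trans
    (interior_biUnion_eq_empty_of_finite hfin (fun s _ => ?_) fun s hs => ?_).subset
  · exact isClosed_connectedComponentIn hO.isClosed_compl s
  · by_contra hnon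
    exact connectedComponentIn_subset _ _ (hx _
      ⟨(isClosed_connectedComponentIn hO.isClosed_compl s).isCompact,
        isConnected_connectedComponentIn_iff.2 (hSsub hs)⟩ (nonempty_iff_ne_empty.2 hnon)) hxk

/-- Otherwise, compactness would produce a nonblocker containing the complement of a proper
continuum with nonempty interior. -/
theorem exists_isSubcontinuum_interior_nonempty_notMem (hdec : Decomposable X)
    (hKelley : PropertyOfKelley X) (hNB : IsCompact (NB X)) (x : X) :
    ∃ K : Set X, IsSubcontinuum K ∧ (interior K).Nonempty ∧ x ∉ K := by
  by_contra! hx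
  obtain ⟨M, N, hM, hN, hMu, hNu, hMN⟩ := hdec
  have hint : (interior M).Nonempty := by
    refine (nonempty_compl.2 hNu).mono (interior_maximal (fun z hz => ?_) hN.1.isClosed.isOpen_compl)
    have : z ∈ M ∪ N := hMN ▸ mem_univ z
    exact this.resolve_right hz
  obtain ⟨p, hp⟩ := nonempty_compl.2 hMu
  have hclosed : ∀ s : ↥(Mᶜ), IsClosed {A : NonemptyCompacts X | (s : X) ∈ A} := fun s => by
    simpa using NonemptyCompacts.isClosed_inter_nonempty_of_isClosed (isClosed_singleton (x := (s : X)))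
  obtain ⟨A, hA, hAs⟩ := hNB.inter_iInter_nonempty
    (fun s : ↥(Mᶜ) => {A : NonemptyCompacts X | (s : X) ∈ A}) hclosed fun t => by
      -- The point `p` is inserted to have a nonempty set when `t` is empty.
      have hfin : (insert p ((↑) '' (t : Set ↥(Mᶜ))) : Set X).Finite :=
        (t.finite_toSet.image _).insert p
      have hMS : M ⊆ (insert p ((↑) '' (t : Set ↥(Mᶜ))) : Set X)ᶜ := by
        rintro m hm (rfl | ⟨s, -, rfl⟩)
        · exact hp hm
        · exact s.2 hm
      obtain ⟨A, hA, hAeq⟩ := exists_mem_NB_coe_eq_compl_kappa hKelley hM hint hfin.isClosed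
        (insert_nonempty _ _) hMS
        (dense_kappa_of_finite hKelley hx hM hint hfin (insert_nonempty _ _) hMS)
      refine ⟨A, hA, mem_iInter₂.2 fun s hs => ?_⟩
      change (s : X) ∈ (A : Set X)
      rw [hAeq]
      exact fun h => kappa_subset_compl _ _ h (Or.inr ⟨s, hs, rfl⟩)
  have hsub : Mᶜ ⊆ interior (A : Set X) :=
    interior_maximal (fun s hs => mem_iInter.1 hAs ⟨s, hs⟩) hM.1.isClosed.isOpen_compl
  rw [interior_eq_empty_of_mem_NB hA] at hsub
  exact hsub hp

end Metric

/-! ### The set of blocked points -/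

section BlockedSet

variable {X : Type*} [MetricSpace X] {K : Set X} {x : X}

theorem blockedSet_subset_of_mem_NB {A : NonemptyCompacts X} (hA : A ∈ NB X) (hx : x ∈ A) :
    blockedSet x ⊆ A := by
  intro y hy
  by_contra hyA
  have hd : Dense (kappa (A : Set X) {y}) := dense_iff_closure_eq.2 (not_not.1 (hA.2 y hyA))
  exact hy (hd.mono (kappa_anti_left (singleton_subset_iff.2 hx) _)).closure_eq

theorem blockedSet_subset_minimalNonblocker (x : X) : blockedSet x ⊆ minimalNonblocker x := by
  unfold minimalNonblocker
  split_ifs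
  · exact subset_iInter₂ fun A hA => blockedSet_subset_of_mem_NB hA.1 hA.2
  · exact subset_univ _

theorem minimalNonblocker_subset_of_mem_NB {A : NonemptyCompacts X} (hA : A ∈ NB X)
    (hx : x ∈ A) : minimalNonblocker x ⊆ A := by
  rw [minimalNonblocker, if_pos ⟨A, hA, hx⟩]
  exact iInter₂_subset A ⟨hA, hx⟩

/-- If `x` misses a continuum `K` with nonempty interior and does not block every point, then the
set of points blocked by `x` is the hull of `{x}`. -/
theorem exists_mem_NB_coe_eq_blockedSet [CompactSpace X] (hKelley : PropertyOfKelley X)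
    (hK : IsSubcontinuum K) (hint : (interior K).Nonempty) (hxK : x ∉ K)
    (hB : blockedSet x ≠ univ) :
    ∃ A ∈ NB X, (A : Set X) = blockedSet x := by
  have hKx : K ⊆ {x}ᶜ := by simpa using hxK
  have key : ∀ z ∈ kappa {x} K, kappa {x} K ⊆ kappa {x} {z} := fun z hz =>
    (kappa_subset_kappa_compl_kappa hK hKx hz).trans
      (kappa_anti_left (subset_compl_comm.1 (kappa_subset_compl _ _)) _)
  obtain ⟨y, hy⟩ := (ne_univ_iff_exists_notMem _).1 hB
  have hyd : Dense (kappa {x} {y}) := dense_iff_closure_eq.2 (not_not.1 hy)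
  have hd : Dense (kappa {x} K) := by
    refine hyd.mono fun w hw => ?_
    obtain ⟨L, hL, ⟨_, rfl, hyL⟩, hLx, hwL⟩ := mem_kappa.1 hw
    obtain ⟨L', hL', hKL', hLx', hyL'⟩ :=
      exists_isSubcontinuum_of_mem_kappa hK hKx (mem_kappa_of_dense hint hyd)
    obtain ⟨k, hk⟩ := hK.2.nonempty
    exact mem_kappa.2 ⟨L' ∪ L, hL'.union hL ⟨_, hyL', hyL⟩, ⟨k, hk, Or.inl (hKL' hk)⟩,
      union_subset hLx' hLx, Or.inr hwL⟩
  have hEq : (kappa {x} K)ᶜ = blockedSet x := by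
    ext z
    constructor
    · exact fun hz hzd => hz (mem_kappa_of_dense hint (dense_iff_closure_eq.2 hzd))
    · exact fun hz hzK => hz (hd.mono (key z hzK)).closure_eq
  rw [← hEq]
  exact exists_mem_NB_coe_eq_compl_kappa hKelley hK hint isClosed_singleton
    (singleton_nonempty x) hKx hd

end BlockedSet

end Nonblockers

theorem mainTheorem11 {X : Type*} [MetricSpace X] [CompactSpace X] [ConnectedSpace X]
    (hdec : Nonblockers.Decomposable X) (hKelley : Nonblockers.PropertyOfKelley X)
    (hNB : Nonblockers.IsSubcontinuum (Nonblockers.NB X)) (x : X) :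
    Nonblockers.minimalNonblocker x = Nonblockers.blockedSet x ∧
      IsClosed (Nonblockers.blockedSet x) := by
  have hsub := Nonblockers.blockedSet_subset_minimalNonblocker x
  by_cases hB : Nonblockers.blockedSet x = univ
  · rw [hB] at hsub ⊢
    exact ⟨univ_subset_iff.1 hsub, isClosed_univ⟩
  obtain ⟨K, hK, hint, hxK⟩ :=
    Nonblockers.exists_isSubcontinuum_interior_nonempty_notMem hdec hKelley hNB.1 x
  obtain ⟨A, hA, hAB⟩ :=
    Nonblockers.exists_mem_NB_coe_eq_blockedSet hKelley hK hint hxK hB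
  have hxA : x ∈ (A : Set X) := hAB ▸ Nonblockers.mem_blockedSet_self x
  refine ⟨(hAB ▸ Nonblockers.minimalNonblocker_subset_of_mem_NB hA hxA).antisymm hsub, ?_⟩
  rw [← hAB]
  exact A.isCompact.isClosed
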